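/- **Proposition 4.5.** Let $k$ be a field, $n\ge 1$, and let $B=k[T_1,\dots,T_n]$ be $\mathbb{Z}^2$-graded by $\deg T_i=(d_i,1)$ with $d_i\in\mathbb{Z}$. Put $E=\{d_1,\dots,d_n\}$ and $$\Lambda=\bigcap_{e<e' \text{ in } E}\bigl(\mathbb{Z}(e,1)+\mathbb{Z}(e',1)\bigr)\subseteq\mathbb{Z}^2$$ (so $\Lambda=\mathbb{Z}^2$ if $E$ has only one element). A function $f:\mathbb{Z}^2\to\mathbb{Q}$ is called a quasi-polynomial with respect to $\Lambda$ if there are polynomials $P_c\in\mathbb{Q}[x,y]$, $c\in\mathbb{Z}^2/\Lambda$, such that $f(s)=P_c(s)$ whenever $s\in\mathbb{Z}^2$ lies in the class $c$. Let $M$ be a finitely generated $\mathbb{Z}^2$-graded $B$-module. Then there exist $t_0\in\mathbb{Z}$, an integer $N\ge 1$, half-lines $L_i(t)=a_it+b_i$ ($1\le i\le N$) with $a_i,b_i\in\mathbb{Z}$ and $\{a_1,\dots,a_N\}=E$, and quasi-polynomials $Q_1,\dots,Q_{N-1}:\mathbb{Z}^2\to\mathbb{Q}$ with respect to $\Lambda$,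 such that for all integers $t\ge t_0$: 1. $L_i(t)<L_j(t)$ if and only if $i<j$, for all $1\le i,j\le N$; 2. $M_{\mu,t}=0$ for every $\mu\in\mathbb{Z}$ with $\mu<L_1(t)$ or $\mu>L_N(t)$; 3. for every $1\le i<N$ and every $\mu\in\mathbb{Z}$ with $L_i(t)\le\mu\le L_{i+1}(t)$, the $k$-vector space $M_{\mu,t}$ is finite-dimensional and $\dim_k M_{\mu,t}=Q_i(\mu,t)$. -/

import Mathlib

/-- The lattice `Λ` attached to a set `E` of integers: the intersection, over all pairs `e < e'`
in `E`, of the sublattice of `ℤ²` spanned by `(e, 1)` and `(e', 1)`. -/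
def degreeLattice (E : Set ℤ) : AddSubgroup (ℤ × ℤ) :=
  ⨅ e ∈ E, ⨅ e' ∈ E, ⨅ _ : e < e', AddSubgroup.closure {((e, 1) : ℤ × ℤ), (e', 1)}

/-- A function `f : ℤ² → ℚ` is a quasi-polynomial with respect to `Λ` if there is a family of
polynomials with rational coefficients, indexed by `ℤ² / Λ`, such that `f` agrees on every
residue class modulo `Λ` with the corresponding polynomial. -/
def IsQuasiPolynomial (Λ : AddSubgroup (ℤ × ℤ)) (f : ℤ × ℤ → ℚ) : Prop :=
  ∃ P : (ℤ × ℤ) ⧸ Λ → MvPolynomial (Fin 2) ℚ,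
    ∀ s : ℤ × ℤ, f s = MvPolynomial.eval ![(s.1 : ℚ), (s.2 : ℚ)] (P (QuotientAddGroup.mk s))

/-- The `ℤ²`-grading of `B = k[T_1, …, T_n]` with `deg T_i = (d_i, 1)`: the component of a degree
is the space of polynomials that are homogeneous of this degree. -/
noncomputable abbrev bigrading (k : Type*) [Field k] {n : ℕ} (d : Fin n → ℤ) :
    ℤ × ℤ → Submodule k (MvPolynomial (Fin n) k) :=
  MvPolynomial.weightedHomogeneousSubmodule k fun i => ((d i, 1) : ℤ × ℤ)

/-! Write δ_i = (d_i, 1) and H(s) = dim M_s, and let ℚ[ℤ²] act on functions on ℤ² by translation.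
The product of all x^{δ_i} - 1 turns H into a function of finite support
(`finite_support_prod_diffElt`). This and the vanishing of H for small t, recorded in `HilbertLike`,
are all that the asymptotics use.

If ℓ is a linear form with ℓ(δ_i) ≤ 0, the factor x^{δ_i} - 1 can be cancelled on a half-plane ℓ >
C. For neighbouring slopes e < e', cancelling in two ways shows that, deep in the cone between them,
H is killed both by the product over d_i ≤ e and by the product over d_i ≥ e'. A prime containing
both products contains x^{δ_i} - 1 and x^{δ_j} - 1 for some such pair, hence x^l - 1 for every l in
Λ. So a power of x^l - 1 kills H deep in the cone (`diffElt_mem_radical`). Newton's formula then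
gives polynomials along periods, which glue to one polynomial per class modulo Λ
(`exists_isQuasiPolynomial_on_cone`).

The same argument along a single line of slope e gives a quasi-polynomial for large t. Finitely many
such lines for each slope fill the gaps between the deep cones (`HilbertLike.exists_lines`). -/

namespace BigradedHilbert

/-! ### Laurent polynomials acting by translation -/

/-- The Laurent polynomial ring `ℚ[ℤ²]` acts on functions on `ℤ²` by translation. -/
noncomputable def shiftAction :
    AddMonoidAlgebra ℚ (ℤ × ℤ) →ₐ[ℚ] Module.End ℚ (ℤ × ℤ → ℚ) :=
  AddMonoidAlgebra.lift ℚ _ _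
    { toFun := fun a => LinearMap.funLeft ℚ ℚ fun s => s + a.toAdd
      map_one' := by ext; simp
      map_mul' := fun a b => by
        ext f s
        simp [LinearMap.funLeft_apply, add_assoc] }

lemma shiftAction_single (a : ℤ × ℤ) (c : ℚ) (f : ℤ × ℤ → ℚ) (s : ℤ × ℤ) :
    shiftAction (AddMonoidAlgebra.single a c) f s = c * f (s + a) := by
  simp [shiftAction, LinearMap.funLeft_apply]

/-- The element `x ^ a - 1` of the Laurent polynomial ring. -/
noncomputable def diffElt (a : ℤ × ℤ) : AddMonoidAlgebra ℚ (ℤ × ℤ) :=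
  AddMonoidAlgebra.single a 1 - 1

lemma shiftAction_diffElt (a : ℤ × ℤ) (f : ℤ × ℤ → ℚ) :
    shiftAction (diffElt a) f = fwdDiff a f := by
  ext s
  simp [diffElt, fwdDiff, shiftAction_single]

lemma shiftAction_diffElt_pow (a : ℤ × ℤ) (m : ℕ) (f : ℤ × ℤ → ℚ) :
    shiftAction (diffElt a ^ m) f = (fwdDiff a)^[m] f := by
  induction m with
  | zero => simp
  | succ m ih =>
    rw [pow_succ', map_mul, Module.End.mul_apply, ih, shiftAction_diffElt,
      Function.iterate_succ_apply']

/-- The degrees `a` with `x ^ a ≡ 1` modulo an ideal. -/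
def trivialShifts (P : Ideal (AddMonoidAlgebra ℚ (ℤ × ℤ))) : AddSubgroup (ℤ × ℤ) where
  carrier := {a | diffElt a ∈ P}
  zero_mem' := by simp [diffElt, AddMonoidAlgebra.one_def]
  add_mem' := by
    intro a b ha hb
    have : diffElt (a + b) = AddMonoidAlgebra.single a 1 * diffElt b + diffElt a := by
      simp [diffElt, mul_sub, AddMonoidAlgebra.single_mul_single]
    simp only [Set.mem_ofPred_eq] at *
    rw [this]
    exact P.add_mem (P.mul_mem_left _ hb) ha
  neg_mem' := by
    intro a ha
    have : diffElt (-a) = AddMonoidAlgebra.single (-a) (-1) * diffElt a := by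
      simp [diffElt, mul_sub, AddMonoidAlgebra.single_mul_single, AddMonoidAlgebra.one_def,
        AddMonoidAlgebra.single_neg]
      abel
    simp only [Set.mem_ofPred_eq] at *
    rw [this]
    exact P.mul_mem_left _ ha

lemma mem_trivialShifts {P : Ideal (AddMonoidAlgebra ℚ (ℤ × ℤ))} {a : ℤ × ℤ} :
    a ∈ trivialShifts P ↔ diffElt a ∈ P := Iff.rfl

section Family

variable {ι : Type*} (δ : ι → ℤ × ℤ)

/-- The radical is the intersection of the primes P above the ideal. Such a P contains one factor of
each product, so the subgroup `trivialShifts P` contains some δ i and δ j, and therefore l. -/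
lemma diffElt_mem_radical (S₁ S₂ : Finset ι) (l : ℤ × ℤ)
    (h : ∀ i ∈ S₁, ∀ j ∈ S₂, l ∈ AddSubgroup.closure {δ i, δ j}) :
    diffElt l ∈ (Ideal.span {∏ i ∈ S₁, diffElt (δ i), ∏ i ∈ S₂, diffElt (δ i)}).radical := by
  rw [Ideal.radical_eq_sInf, Ideal.mem_sInf]
  rintro P ⟨hle, hP⟩
  have h₁ := hle (Ideal.subset_span (Set.mem_insert _ _))
  have h₂ := hle (Ideal.subset_span (Set.mem_insert_of_mem _ rfl))
  rw [hP.prod_mem_iff] at h₁ h₂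
  obtain ⟨i, hi, hiP⟩ := h₁
  obtain ⟨j, hj, hjP⟩ := h₂
  refine mem_trivialShifts.1 ((AddSubgroup.closure_le (trivialShifts P)).2 ?_ (h i hi j hj))
  rintro x (rfl | rfl)
  · exact hiP
  · exact hjP

end Family

/-! ### Vanishing on half-planes and cancellation of factors -/

/-- The function `f` vanishes on the half-plane `ℓ > C` for some `C`. -/
def VanishesFar (ℓ : ℤ × ℤ →+ ℤ) (f : ℤ × ℤ → ℚ) : Prop :=
  ∃ C : ℤ, ∀ s, C < ℓ s → f s = 0

lemma VanishesFar.shiftAction {ℓ : ℤ × ℤ →+ ℤ} {f : ℤ × ℤ → ℚ} (hf : VanishesFar ℓ f)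
    (A : AddMonoidAlgebra ℚ (ℤ × ℤ)) : VanishesFar ℓ (shiftAction A f) := by
  induction A using AddMonoidAlgebra.induction_linear with
  | zero => exact ⟨0, by simp⟩
  | add A B hA hB =>
    obtain ⟨C, hC⟩ := hA
    obtain ⟨C', hC'⟩ := hB
    refine ⟨max C C', fun s hs => ?_⟩
    have h1 := hC s (lt_of_le_of_lt (le_max_left _ _) hs)
    have h2 := hC' s (lt_of_le_of_lt (le_max_right _ _) hs)
    simp [h1, h2]
  | single a c =>
    obtain ⟨C, hC⟩ := hf
    refine ⟨C - ℓ a, fun s hs => ?_⟩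
    rw [shiftAction_single, hC, mul_zero]
    rw [map_add]; omega

/-- Passing from s to s - δ does not decrease ℓ, so it stays in the half-plane and leaves the value
of f unchanged there. It lowers the second coordinate by 1, so the region where f vanishes is
eventually reached. -/
lemma VanishesFar.of_fwdDiff {ℓ : ℤ × ℤ →+ ℤ} {f : ℤ × ℤ → ℚ} {δ : ℤ × ℤ} (hδ : ℓ δ ≤ 0)
    (hδ₁ : δ.2 = 1) (hf : ∃ T : ℤ, ∀ s : ℤ × ℤ, s.2 < T → f s = 0)
    (h : VanishesFar ℓ (fwdDiff δ f)) : VanishesFar ℓ f := by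
  obtain ⟨C, hC⟩ := h
  obtain ⟨T, hT⟩ := hf
  refine ⟨C, ?_⟩
  have key : ∀ j : ℕ, ∀ s : ℤ × ℤ, s.2 < T + j → C < ℓ s → f s = 0 := by
    intro j
    induction j with
    | zero => intro s hs _; exact hT s (by simpa using hs)
    | succ j ih =>
      intro s hs hCs
      have h1 : C < ℓ (s - δ) := by rw [map_sub]; omega
      have h2 := hC _ h1
      have h3 := ih (s - δ) (by simp [hδ₁]; push_cast at hs; omega) h1
      simpa [fwdDiff, h3] using h2
  intro s hs
  exact key (s.2 - T + 1).toNat s (by omega) hs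

lemma vanishesBelow_shiftAction {f : ℤ × ℤ → ℚ} (hf : ∃ T : ℤ, ∀ s : ℤ × ℤ, s.2 < T → f s = 0)
    (A : AddMonoidAlgebra ℚ (ℤ × ℤ)) :
    ∃ T : ℤ, ∀ s : ℤ × ℤ, s.2 < T → shiftAction A f s = 0 := by
  obtain ⟨T, hT⟩ := hf
  obtain ⟨C, hC⟩ := VanishesFar.shiftAction (ℓ := -AddMonoidHom.snd ℤ ℤ) (f := f)
    ⟨-T, fun s hs => hT s (by simpa using hs)⟩ A
  exact ⟨-C, fun s hs => hC s (by simp; omega)⟩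

section Family

variable {ι : Type*} {δ : ι → ℤ × ℤ}

lemma VanishesFar.of_prod {ℓ : ℤ × ℤ →+ ℤ} (S : Finset ι) (hδ : ∀ i ∈ S, ℓ (δ i) ≤ 0)
    (hδ₁ : ∀ i, (δ i).2 = 1) {f : ℤ × ℤ → ℚ}
    (hf : ∃ T : ℤ, ∀ s : ℤ × ℤ, s.2 < T → f s = 0)
    (h : VanishesFar ℓ (BigradedHilbert.shiftAction (∏ i ∈ S, diffElt (δ i)) f)) :
    VanishesFar ℓ f := by
  classical
  induction S using Finset.induction_on with
  | empty => simpa using h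
  | insert i S hi ih =>
    refine ih (fun j hj => hδ j (Finset.mem_insert_of_mem hj)) ?_
    rw [Finset.prod_insert hi, map_mul, Module.End.mul_apply, shiftAction_diffElt] at h
    exact h.of_fwdDiff (hδ i (Finset.mem_insert_self _ _)) (hδ₁ i) (vanishesBelow_shiftAction hf _)

lemma vanishesFar_of_finite {ℓ : ℤ × ℤ →+ ℤ} {f : ℤ × ℤ → ℚ}
    (hf : (Function.support f).Finite) : VanishesFar ℓ f := by
  obtain ⟨C, hC⟩ := (hf.image ℓ).bddAbove
  refine ⟨C, fun s hs => ?_⟩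
  by_contra h
  exact absurd (hC ⟨s, h, rfl⟩) (not_le.2 hs)

/-- Functions on `ℤ²` behaving like the Hilbert function of a finitely generated bigraded
module over a polynomial ring with variables of degrees `δ`. -/
structure HilbertLike [Fintype ι] (δ : ι → ℤ × ℤ) (f : ℤ × ℤ → ℚ) : Prop where
  below : ∃ T : ℤ, ∀ s : ℤ × ℤ, s.2 < T → f s = 0
  finite : (Function.support (shiftAction (∏ i, diffElt (δ i)) f)).Finite

/-- Only the factors with ℓ (δ i) > 0 are needed to kill f far out in the direction of ℓ; the others
are cancelled from the full product. -/
lemma HilbertLike.vanishesFar_prod [Fintype ι] {f : ℤ × ℤ → ℚ} (hf : HilbertLike δ f)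
    (hδ₁ : ∀ i, (δ i).2 = 1) {ℓ : ℤ × ℤ →+ ℤ} (S : Finset ι) (hS : ∀ i ∉ S, ℓ (δ i) ≤ 0) :
    VanishesFar ℓ (shiftAction (∏ i ∈ S, diffElt (δ i)) f) := by
  classical
  refine VanishesFar.of_prod (δ := δ) Sᶜ (fun i hi => hS i (Finset.mem_compl.1 hi)) hδ₁
    (vanishesBelow_shiftAction hf.below _) ?_
  rw [← Module.End.mul_apply, ← map_mul, mul_comm, Finset.prod_mul_prod_compl]
  exact vanishesFar_of_finite hf.finite

/-- Away from the directions `S₁` and `S₂`, iterated differences along a common period vanish. -/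
lemma HilbertLike.exists_iterate_fwdDiff_eq_zero [Fintype ι] {f : ℤ × ℤ → ℚ}
    (hf : HilbertLike δ f) (hδ₁ : ∀ i, (δ i).2 = 1) {ℓ₁ ℓ₂ : ℤ × ℤ →+ ℤ} (S₁ S₂ : Finset ι)
    (hS₁ : ∀ i ∉ S₁, ℓ₁ (δ i) ≤ 0) (hS₂ : ∀ i ∉ S₂, ℓ₂ (δ i) ≤ 0) (l : ℤ × ℤ)
    (hl : ∀ i ∈ S₁, ∀ j ∈ S₂, l ∈ AddSubgroup.closure {δ i, δ j}) :
    ∃ (m : ℕ) (C : ℤ), ∀ s, C < ℓ₁ s → C < ℓ₂ s → (fwdDiff l)^[m] f s = 0 := by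
  obtain ⟨m, hm⟩ := diffElt_mem_radical δ S₁ S₂ l hl
  -- (x^l - 1)^m is a combination of the two products, and each summand kills f on its own
  -- half-plane.
  obtain ⟨A, B, hAB⟩ := Ideal.mem_span_pair.1 hm
  obtain ⟨C₁, hC₁⟩ := (hf.vanishesFar_prod hδ₁ S₁ hS₁).shiftAction A
  obtain ⟨C₂, hC₂⟩ := (hf.vanishesFar_prod hδ₁ S₂ hS₂).shiftAction B
  refine ⟨m, max C₁ C₂, fun s h₁ h₂ => ?_⟩
  rw [← shiftAction_diffElt_pow, ← hAB, map_add, map_mul, map_mul, LinearMap.add_apply,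
    Pi.add_apply, Module.End.mul_apply, Module.End.mul_apply, hC₁ s (by omega), hC₂ s (by omega),
    add_zero]

end Family

/-! ### Newton expansion and polynomiality along periods -/

lemma exists_choose_polynomial (k : ℕ) :
    ∃ p : Polynomial ℚ, ∀ n : ℕ, p.eval (n : ℚ) = n.choose k := by
  refine ⟨Polynomial.C ((k.factorial : ℚ)⁻¹) * descPochhammer ℚ k, fun n => ?_⟩
  rw [Nat.cast_choose_eq_descPochhammer_div]
  simp [div_eq_inv_mul]

section Newton

variable {V : Type*} [AddCommGroup V]

lemma iterate_fwdDiff_eq_zero_of_le {f : V → ℚ} {l : V} {m k : ℕ} (hmk : m ≤ k) {R : Set V}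
    (hR : ∀ s ∈ R, s + l ∈ R) (h : ∀ s ∈ R, (fwdDiff l)^[m] f s = 0) :
    ∀ s ∈ R, (fwdDiff l)^[k] f s = 0 := by
  induction k, hmk using Nat.le_induction with
  | base => exact h
  | succ k _ ih =>
    intro s hs
    rw [Function.iterate_succ_apply', fwdDiff, ih s hs, ih _ (hR s hs), sub_zero]

lemma add_nsmul_mem_of_add_mem {l : V} {R : Set V} (hR : ∀ s ∈ R, s + l ∈ R) {s : V} (hs : s ∈ R)
    (n : ℕ) : s + n • l ∈ R := by
  induction n with
  | zero => simpa using hs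
  | succ n ih => rw [succ_nsmul, ← add_assoc]; exact hR _ ih

lemma newton_of_iterate_fwdDiff_eq_zero {f : V → ℚ} {l : V} {m : ℕ} {R : Set V}
    (hR : ∀ s ∈ R, s + l ∈ R) (h : ∀ s ∈ R, (fwdDiff l)^[m] f s = 0) {s : V} (hs : s ∈ R)
    (n : ℕ) : f (s + n • l) = ∑ k ∈ Finset.range m, (n.choose k : ℚ) * (fwdDiff l)^[k] f s := by
  rw [shift_eq_sum_fwdDiff_iter l f n s]
  simp only [nsmul_eq_mul]
  rcases le_total m (n + 1) with hmn | hmn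
  · symm
    apply Finset.sum_subset (Finset.range_mono hmn)
    intro k _ hk
    rw [iterate_fwdDiff_eq_zero_of_le (by simpa using hk) hR h s hs, mul_zero]
  · apply Finset.sum_subset (Finset.range_mono hmn)
    intro k _ hk
    rw [Nat.choose_eq_zero_of_lt (by simpa using hk), Nat.cast_zero, zero_mul]

lemma exists_polynomial_of_iterate_fwdDiff_eq_zero {f : V → ℚ} {l : V} {m : ℕ} {R : Set V}
    (hR : ∀ s ∈ R, s + l ∈ R) (h : ∀ s ∈ R, (fwdDiff l)^[m] f s = 0) {s : V} (hs : s ∈ R) :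
    ∃ p : Polynomial ℚ, ∀ n : ℕ, f (s + n • l) = p.eval (n : ℚ) := by
  choose p hp using exists_choose_polynomial
  refine ⟨∑ k ∈ Finset.range m, p k * Polynomial.C ((fwdDiff l)^[k] f s), fun n => ?_⟩
  rw [newton_of_iterate_fwdDiff_eq_zero hR h hs n]
  simp [Polynomial.eval_finsetSum, hp]

lemma iterate_fwdDiff_comm (a b : V) (i j : ℕ) (f : V → ℚ) :
    (fwdDiff a)^[i] ((fwdDiff b)^[j] f) = (fwdDiff b)^[j] ((fwdDiff a)^[i] f) := by
  have : Function.Commute (fwdDiff a : (V → ℚ) → V → ℚ) (fwdDiff b) := by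
    intro f
    ext s
    simp only [fwdDiff, add_right_comm s a b]
    ring
  exact (this.iterate_iterate i j) f

lemma iterate_fwdDiff_zero_on {f : V → ℚ} {l : V} {R : Set V} (hR : ∀ s ∈ R, s + l ∈ R)
    (h : ∀ s ∈ R, f s = 0) (k : ℕ) : ∀ s ∈ R, (fwdDiff l)^[k] f s = 0 :=
  iterate_fwdDiff_eq_zero_of_le (m := 0) (Nat.zero_le k) hR h

/-- Expand by Newton in the direction a. The coefficients are differences of f along a; they are
still killed by the m-th difference along b, hence polynomial in j. -/
lemma exists_mvPolynomial_of_iterate_fwdDiff_eq_zero {f : V → ℚ} {a b : V} {m : ℕ} {R : Set V}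
    (hRa : ∀ s ∈ R, s + a ∈ R) (hRb : ∀ s ∈ R, s + b ∈ R)
    (ha : ∀ s ∈ R, (fwdDiff a)^[m] f s = 0) (hb : ∀ s ∈ R, (fwdDiff b)^[m] f s = 0)
    {s : V} (hs : s ∈ R) :
    ∃ P : MvPolynomial (Fin 2) ℚ, ∀ i j : ℕ,
      f (s + i • a + j • b) = MvPolynomial.eval ![(i : ℚ), (j : ℚ)] P := by
  have h1 : ∀ k : ℕ, ∃ p : Polynomial ℚ, ∀ n : ℕ,
      (fwdDiff a)^[k] f (s + n • b) = p.eval (n : ℚ) := by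
    intro k
    refine exists_polynomial_of_iterate_fwdDiff_eq_zero (m := m) hRb ?_ hs
    rw [iterate_fwdDiff_comm]
    exact iterate_fwdDiff_zero_on hRa hb k
  choose c hc using h1
  choose p hp using exists_choose_polynomial
  have hev : ∀ (x : Fin 2 → ℚ) (q : Polynomial ℚ) (i : Fin 2),
      MvPolynomial.eval x (Polynomial.aeval (MvPolynomial.X i) q) = q.eval (x i) := by
    intro x q i
    have := Polynomial.aeval_algHom_apply (MvPolynomial.aeval x) (MvPolynomial.X i) q
    rw [MvPolynomial.aeval_X] at this
    simpa [MvPolynomial.aeval_eq_eval, Polynomial.aeval_def] using this.symm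
  refine ⟨∑ k ∈ Finset.range m, Polynomial.aeval (MvPolynomial.X 0) (p k) *
    Polynomial.aeval (MvPolynomial.X 1) (c k), fun i j => ?_⟩
  rw [add_right_comm, newton_of_iterate_fwdDiff_eq_zero hRa ha
    (add_nsmul_mem_of_add_mem hRb hs j) i, map_sum]
  refine Finset.sum_congr rfl fun k _ => ?_
  rw [map_mul, hev, hev, hc]
  simp [hp]

end Newton

/-! ### Quasi-polynomials on lines and cones -/

/-- The point of `ℚ²` given by a pair of integers. -/
def ratPoint (s : ℤ × ℤ) : Fin 2 → ℚ := ![(s.1 : ℚ), (s.2 : ℚ)]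

lemma exists_comp_mvPolynomial (P p q : MvPolynomial (Fin 2) ℚ) :
    ∃ P' : MvPolynomial (Fin 2) ℚ, ∀ x : Fin 2 → ℚ, MvPolynomial.eval x P' =
      MvPolynomial.eval ![MvPolynomial.eval x p, MvPolynomial.eval x q] P := by
  refine ⟨MvPolynomial.bind₁ ![p, q] P, fun x => ?_⟩
  rw [MvPolynomial.eval, MvPolynomial.eval₂Hom_bind₁]
  congr 2
  ext i
  fin_cases i <;> rfl

lemma exists_comp_polynomial (P : Polynomial ℚ) (p : MvPolynomial (Fin 2) ℚ) :
    ∃ P' : MvPolynomial (Fin 2) ℚ, ∀ x : Fin 2 → ℚ, MvPolynomial.eval x P' =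
      P.eval (MvPolynomial.eval x p) := by
  refine ⟨Polynomial.aeval p P, fun x => ?_⟩
  have := Polynomial.aeval_algHom_apply (MvPolynomial.aeval x) p P
  simpa [MvPolynomial.aeval_eq_eval, Polynomial.aeval_def] using this.symm

lemma exists_affine_mvPolynomial (a b c : ℚ) :
    ∃ P : MvPolynomial (Fin 2) ℚ, ∀ s : ℤ × ℤ,
      MvPolynomial.eval (ratPoint s) P = a * s.1 + b * s.2 + c :=
  ⟨.C a * .X 0 + .C b * .X 1 + .C c, fun s => by simp [ratPoint]⟩

section Quasi

variable {Λ : AddSubgroup (ℤ × ℤ)}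

lemma exists_isQuasiPolynomial_of_classes (f : ℤ × ℤ → ℚ) (R : Set (ℤ × ℤ))
    (h : ∀ u ∈ R, ∃ P : MvPolynomial (Fin 2) ℚ, ∀ s ∈ R, s - u ∈ Λ →
      f s = MvPolynomial.eval (ratPoint s) P) :
    ∃ Q, IsQuasiPolynomial Λ Q ∧ ∀ s ∈ R, f s = Q s := by
  have h' : ∀ c : (ℤ × ℤ) ⧸ Λ, ∃ P : MvPolynomial (Fin 2) ℚ, ∀ s ∈ R,
      QuotientAddGroup.mk s = c → f s = MvPolynomial.eval (ratPoint s) P := by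
    intro c
    by_cases hc : ∃ u ∈ R, (QuotientAddGroup.mk u : (ℤ × ℤ) ⧸ Λ) = c
    · obtain ⟨u, hu, rfl⟩ := hc
      obtain ⟨P, hP⟩ := h u hu
      refine ⟨P, fun s hs hsu => hP s hs ?_⟩
      rw [eq_comm, QuotientAddGroup.eq] at hsu
      rwa [sub_eq_neg_add]
    · push Not at hc
      exact ⟨0, fun s hs hsc => absurd hsc (hc s hs)⟩
  choose P hP using h'
  exact ⟨fun s => MvPolynomial.eval (ratPoint s) (P (QuotientAddGroup.mk s)),
    ⟨P, fun s => rfl⟩, fun s hs => hP _ s hs rfl⟩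

/-- The affine weights are (1, 0) on the line x = a t + b and (0, 1) on x = a t + b + 1, so the
combination equals Q₁ on the first line and Q₂ on the second. -/
lemma isQuasiPolynomial_interpolate {Q₁ Q₂ : ℤ × ℤ → ℚ} (h₁ : IsQuasiPolynomial Λ Q₁)
    (h₂ : IsQuasiPolynomial Λ Q₂) (a b : ℤ) :
    IsQuasiPolynomial Λ fun s => Q₁ s * ((a * s.2 + b + 1 - s.1 : ℤ) : ℚ) +
      Q₂ s * ((s.1 - (a * s.2 + b) : ℤ) : ℚ) := by
  obtain ⟨P₁, hP₁⟩ := h₁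
  obtain ⟨P₂, hP₂⟩ := h₂
  obtain ⟨A, hA⟩ := exists_affine_mvPolynomial (-1) a (b + 1)
  obtain ⟨B, hB⟩ := exists_affine_mvPolynomial 1 (-a) (-b)
  refine ⟨fun c => P₁ c * A + P₂ c * B, fun s => ?_⟩
  simp only [ratPoint] at hA hB
  beta_reduce
  rw [hP₁, hP₂, map_add, map_mul, map_mul, hA, hB]
  push_cast
  ring

/-- A function annihilated by differences along a line agrees on it with a quasi-polynomial. -/
lemma exists_isQuasiPolynomial_on_line (f : ℤ × ℤ → ℚ) (e b : ℤ)
    (h : ∀ r : ℤ, (r * e, r) ∈ Λ → ∃ (m : ℕ) (T : ℤ), ∀ t, T ≤ t →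
      (fwdDiff (r * e, r))^[m] f (e * t + b, t) = 0) :
    ∃ (t₀ : ℤ) (Q : ℤ × ℤ → ℚ), IsQuasiPolynomial Λ Q ∧
      ∀ t, t₀ ≤ t → f (e * t + b, t) = Q (e * t + b, t) := by
  let φ : ℤ →+ ℤ × ℤ := ((AddMonoidHom.mulRight e).prod (AddMonoidHom.id ℤ))
  have hφ : ∀ r, φ r = (r * e, r) := fun r => rfl
  -- Points of the line in one class modulo Λ differ by multiples of (p e, p), where p generates the
  -- group of r with r (e, 1) in Λ. The value p = 0 is not excluded.
  obtain ⟨p₀, hp₀⟩ := Int.subgroup_cyclic (Λ.comap φ)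
  obtain ⟨p, hp⟩ : ∃ p : ℕ, Λ.comap φ = AddSubgroup.zmultiples (p : ℤ) :=
    ⟨p₀.natAbs, by rw [hp₀, Int.zmultiples_natAbs, AddSubgroup.zmultiples_eq_closure]⟩
  have hpΛ : ((p : ℤ) * e, (p : ℤ)) ∈ Λ := by
    have : (p : ℤ) ∈ Λ.comap φ := by rw [hp]; exact AddSubgroup.mem_zmultiples _
    exact this
  obtain ⟨m, T, hT⟩ := h p hpΛ
  let R : Set (ℤ × ℤ) := {s | s.1 = e * s.2 + b ∧ T ≤ s.2}
  have hR : ∀ s ∈ R, s + ((p : ℤ) * e, (p : ℤ)) ∈ R := by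
    rintro ⟨x, t⟩ ⟨h1, h2⟩
    simp only at h1 h2
    refine ⟨?_, ?_⟩
    · simp only [Prod.mk_add_mk, h1]; ring
    · simp only [Prod.mk_add_mk]; omega
  have hm : ∀ s ∈ R, (fwdDiff ((p : ℤ) * e, (p : ℤ)))^[m] f s = 0 := by
    rintro ⟨x, t⟩ ⟨h1, h2⟩
    simp only at h1 h2
    rw [h1]
    exact hT t h2
  refine ⟨T, ?_⟩
  suffices hcls : ∀ u ∈ R, ∃ P : MvPolynomial (Fin 2) ℚ, ∀ s ∈ R, s - u ∈ Λ →
      f s = MvPolynomial.eval (ratPoint s) P by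
    obtain ⟨Q, hQ, hfQ⟩ := exists_isQuasiPolynomial_of_classes f R hcls
    exact ⟨Q, hQ, fun t ht => hfQ _ ⟨rfl, ht⟩⟩
  intro u hu
  classical
  -- the first point of the class on the line
  have hex : ∃ n : ℕ, (e * (T + n) + b, T + n) - u ∈ Λ := by
    refine ⟨(u.2 - T).toNat, ?_⟩
    have h2 := hu.2
    have : T + ((u.2 - T).toNat : ℤ) = u.2 := by omega
    rw [this, ← hu.1, Prod.mk.eta, sub_self]
    exact Λ.zero_mem
  let n₀ := Nat.find hex
  have hn₀ := Nat.find_spec hex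
  have hs₀ : (e * (T + n₀) + b, T + (n₀ : ℤ)) ∈ R := ⟨rfl, by simp⟩
  obtain ⟨P, hP⟩ := exists_polynomial_of_iterate_fwdDiff_eq_zero hR hm hs₀
  obtain ⟨A, hA⟩ := exists_affine_mvPolynomial 0 ((p : ℚ)⁻¹) (-((p : ℚ)⁻¹ * (T + n₀)))
  obtain ⟨P', hP'⟩ := exists_comp_polynomial P A
  refine ⟨P', ?_⟩
  rintro ⟨x, t⟩ ⟨hx, ht⟩ hsu
  simp only at hx ht
  subst hx
  rw [hP', hA]
  have hle : (n₀ : ℤ) ≤ t - T := by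
    have : n₀ ≤ (t - T).toNat := Nat.find_min' hex (by
      have : T + ((t - T).toNat : ℤ) = t := by omega
      rwa [this])
    omega
  have hmem : t - (T + n₀) ∈ Λ.comap φ := by
    rw [AddSubgroup.mem_comap, hφ]
    convert Λ.sub_mem hsu hn₀ using 1
    ext
    · simp [n₀]; ring
    · simp [n₀]
  rw [hp, Int.mem_zmultiples_iff] at hmem
  obtain ⟨j₀, hj₀⟩ := hmem
  obtain ⟨j, hj⟩ : ∃ j : ℕ, t = T + n₀ + p * j := by
    rcases Nat.eq_zero_or_pos p with h0 | hpos
    · exact ⟨0, by subst h0; simp at hj₀ ⊢; omega⟩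
    · have : 0 ≤ j₀ := by
        by_contra hneg
        have : (p : ℤ) * j₀ < 0 := mul_neg_of_pos_of_neg (by exact_mod_cast hpos) (by omega)
        omega
      exact ⟨j₀.toNat, by rw [Int.toNat_of_nonneg this]; omega⟩
  have hpt : ((e * t + b, t) : ℤ × ℤ) =
      (e * (T + n₀) + b, T + (n₀ : ℤ)) + j • ((p : ℤ) * e, (p : ℤ)) := by
    ext
    · simp [hj]; ring
    · simp [hj]; ring
  -- For p = 0 the class has only one point on this part of the line. Then p⁻¹ = 0, so `A` vanishes
  -- and P' takes the constant value P(0).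
  rcases Nat.eq_zero_or_pos p with h0 | hpos
  · have h1 := hP 0
    have h2 : ((e * t + b, t) : ℤ × ℤ) = (e * (T + n₀) + b, T + (n₀ : ℤ)) := by
      simp [hj, h0]
    rw [h2]
    simpa [h0] using h1
  · rw [hpt, hP]
    congr 1
    have : (p : ℚ) ≠ 0 := by positivity
    simp
    field_simp
    ring

/-- A function annihilated by differences deep inside a cone agrees there with a
quasi-polynomial. -/
lemma exists_isQuasiPolynomial_on_cone (f : ℤ × ℤ → ℚ) {e e' : ℤ} (he : e < e') {p : ℕ}
    (hp : 0 < p) (hpΛ : ∀ s : ℤ × ℤ, p • s ∈ Λ)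
    (h : ∀ l ∈ Λ, ∃ (m : ℕ) (C : ℤ), ∀ s : ℤ × ℤ, C < e' * s.2 - s.1 → C < s.1 - e * s.2 →
      (fwdDiff l)^[m] f s = 0) :
    ∃ (C : ℤ) (Q : ℤ × ℤ → ℚ), IsQuasiPolynomial Λ Q ∧
      ∀ s : ℤ × ℤ, C ≤ e' * s.2 - s.1 → C ≤ s.1 - e * s.2 → f s = Q s := by
  let α : ℤ × ℤ → ℤ := fun s => e' * s.2 - s.1
  let β : ℤ × ℤ → ℤ := fun s => s.1 - e * s.2
  have α_add : ∀ s u, α (s + u) = α s + α u := fun s u => by simp [α]; ring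
  have β_add : ∀ s u, β (s + u) = β s + β u := fun s u => by simp [β]; ring
  have α_sub : ∀ s u, α (s - u) = α s - α u := fun s u => by simp [α]; ring
  have β_sub : ∀ s u, β (s - u) = β s - β u := fun s u => by simp [β]; ring
  have α_smul : ∀ (n : ℤ) s, α (n • s) = n * α s := fun s u => by simp [α]; ring
  have β_smul : ∀ (n : ℤ) s, β (n • s) = n * β s := fun s u => by simp [β]; ring
  have ext_αβ : ∀ s u, α s = α u → β s = β u → s = u := by
    rintro ⟨x, t⟩ ⟨y, v⟩ h1 h2
    simp only [α, β] at h1 h2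
    have h3 : (e' - e) * (t - v) = 0 := by linarith
    rcases mul_eq_zero.1 h3 with h4 | h4
    · omega
    · have : t = v := by omega
      subst this
      simp only [Prod.mk.injEq, and_true]; omega
  -- In the coordinates (α, β) the periods a and b become (q, 0) and (0, q), along the two edges of
  -- the cone.
  let a : ℤ × ℤ := p • (e, 1)
  let b : ℤ × ℤ := p • (e', 1)
  have haΛ : a ∈ Λ := hpΛ _
  have hbΛ : b ∈ Λ := hpΛ _
  obtain ⟨D, hD⟩ : ∃ D : ℕ, e' - e = D := ⟨(e' - e).toNat, by omega⟩
  have hDpos : 0 < D := by omega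
  let q : ℕ := p * D
  have hq : 0 < q := Nat.mul_pos hp hDpos
  have hqZ : (0 : ℤ) < q := by exact_mod_cast hq
  have hαa : α a = q := by simp [α, a, q, ← hD]; ring
  have hβa : β a = 0 := by simp [β, a]; ring
  have hαb : α b = 0 := by simp [α, b]; ring
  have hβb : β b = q := by simp [β, b, q, ← hD]; ring
  -- a finite set of periods in the cone, representing all classes
  let W : Set (ℤ × ℤ) := {w | w ∈ Λ ∧ 0 ≤ α w ∧ α w ≤ q ∧ 0 ≤ β w ∧ β w ≤ q}
  have hWfin : W.Finite := by
    refine Set.Finite.of_finite_image (f := fun w => (α w, β w)) ?_ ?_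
    · refine ((Set.finite_Icc (0 : ℤ) q).prod (Set.finite_Icc (0 : ℤ) q)).subset ?_
      rintro _ ⟨w, ⟨_, h1, h2, h3, h4⟩, rfl⟩
      exact ⟨⟨h1, h2⟩, ⟨h3, h4⟩⟩
    · intro s _ u _ hsu
      exact ext_αβ s u (congrArg Prod.fst hsu) (congrArg Prod.snd hsu)
  have haW : a ∈ W := ⟨haΛ, by omega, by omega, by omega, by omega⟩
  have hbW : b ∈ W := ⟨hbΛ, by omega, by omega, by omega, by omega⟩
  have : Finite W := hWfin
  choose m C hmC using fun w : W => h w.1 w.2.1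
  obtain ⟨M, hM⟩ := (Set.finite_range m).bddAbove
  obtain ⟨C₀, hC₀⟩ := (Set.finite_range C).bddAbove
  let R : Set (ℤ × ℤ) := {s | C₀ < α s ∧ C₀ < β s}
  have hRW : ∀ w ∈ W, ∀ s ∈ R, s + w ∈ R := by
    rintro w ⟨_, h1, _, h2, _⟩ s ⟨h3, h4⟩
    refine ⟨?_, ?_⟩
    · rw [α_add]; omega
    · rw [β_add]; omega
  have hdiff : ∀ w ∈ W, ∀ s ∈ R, (fwdDiff w)^[M] f s = 0 := by
    intro w hw
    refine iterate_fwdDiff_eq_zero_of_le (hM ⟨⟨w, hw⟩, rfl⟩) (hRW w hw) ?_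
    rintro s ⟨h1, h2⟩
    have h3 := hC₀ ⟨⟨w, hw⟩, rfl⟩
    exact hmC ⟨w, hw⟩ s (by simp only [α] at h1; omega) (by simp only [β] at h2; omega)
  refine ⟨C₀ + 1, ?_⟩
  suffices hcls : ∀ u ∈ R, ∃ P : MvPolynomial (Fin 2) ℚ, ∀ s ∈ R, s - u ∈ Λ →
      f s = MvPolynomial.eval (ratPoint s) P by
    obtain ⟨Q, hQ, hfQ⟩ := exists_isQuasiPolynomial_of_classes f R hcls
    exact ⟨Q, hQ, fun s h1 h2 => hfQ s ⟨by simp only [α]; omega, by simp only [β]; omega⟩⟩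
  intro u₀ hu₀
  -- the corner of the class
  let s : ℤ × ℤ := u₀ - ((α u₀ - (C₀ + 1)) / q) • a - ((β u₀ - (C₀ + 1)) / q) • b
  have hαs : α s = (C₀ + 1) + (α u₀ - (C₀ + 1)) % q := by
    have := Int.emod_add_mul_ediv (α u₀ - (C₀ + 1)) q
    simp only [s, α_sub, α_smul, hαa, hαb]
    linarith
  have hβs : β s = (C₀ + 1) + (β u₀ - (C₀ + 1)) % q := by
    have := Int.emod_add_mul_ediv (β u₀ - (C₀ + 1)) q
    simp only [s, β_sub, β_smul, hβa, hβb]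
    linarith
  have hα1 := Int.emod_nonneg (α u₀ - (C₀ + 1)) hqZ.ne'
  have hα2 := Int.emod_lt_of_pos (α u₀ - (C₀ + 1)) hqZ
  have hβ1 := Int.emod_nonneg (β u₀ - (C₀ + 1)) hqZ.ne'
  have hβ2 := Int.emod_lt_of_pos (β u₀ - (C₀ + 1)) hqZ
  have hsR : s ∈ R := ⟨by omega, by omega⟩
  have hsu₀ : u₀ - s ∈ Λ := by
    have : u₀ - s = ((α u₀ - (C₀ + 1)) / q) • a + ((β u₀ - (C₀ + 1)) / q) • b := by
      simp only [s]; abel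
    rw [this]
    exact Λ.add_mem (Λ.zsmul_mem haΛ _) (Λ.zsmul_mem hbΛ _)
  obtain ⟨P, hP⟩ := exists_mvPolynomial_of_iterate_fwdDiff_eq_zero (hRW a haW) (hRW b hbW)
    (hdiff a haW) (hdiff b hbW) hsR
  obtain ⟨A, hA⟩ := exists_affine_mvPolynomial (-(q : ℚ)⁻¹) ((q : ℚ)⁻¹ * e') (-((q : ℚ)⁻¹ * α s))
  obtain ⟨B, hB⟩ := exists_affine_mvPolynomial ((q : ℚ)⁻¹) (-((q : ℚ)⁻¹ * e)) (-((q : ℚ)⁻¹ * β s))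
  obtain ⟨P', hP'⟩ := exists_comp_mvPolynomial P A B
  refine ⟨P', fun u hu huu₀ => ?_⟩
  have huΛ : s - u ∈ Λ := by
    have := Λ.neg_mem (Λ.add_mem huu₀ hsu₀)
    convert this using 1
    abel
  -- The point u agrees with the corner s modulo Λ, but perhaps not modulo ℤa + ℤb, where P' is
  -- known. Reducing s - u into the fundamental parallelogram gives a period w in `W` with u + w in
  -- s + ℤa + ℤb.
  let w : ℤ × ℤ := s - u - (α (s - u) / q) • a - (β (s - u) / q) • b
  have hαw : α w = α (s - u) % q := by
    have := Int.emod_add_mul_ediv (α (s - u)) q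
    simp only [w, α_sub _ (_ • _), α_smul, hαa, hαb]
    linarith
  have hβw : β w = β (s - u) % q := by
    have := Int.emod_add_mul_ediv (β (s - u)) q
    simp only [w, β_sub _ (_ • _), β_smul, hβa, hβb]
    linarith
  have hw1 := Int.emod_nonneg (α (s - u)) hqZ.ne'
  have hw2 := Int.emod_lt_of_pos (α (s - u)) hqZ
  have hw3 := Int.emod_nonneg (β (s - u)) hqZ.ne'
  have hw4 := Int.emod_lt_of_pos (β (s - u)) hqZ
  have hwW : w ∈ W := by
    refine ⟨?_, by omega, by omega, by omega, by omega⟩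
    exact Λ.sub_mem (Λ.sub_mem huΛ (Λ.zsmul_mem haΛ _)) (Λ.zsmul_mem hbΛ _)
  have huw : u + w = s + (-(α (s - u) / q)) • a + (-(β (s - u) / q)) • b := by
    simp only [w, neg_smul]; abel
  -- the class of `u + w` modulo the lattice of `a`, `b` is that of `s`
  have hcorner : ∀ v ∈ R, (∃ x y : ℤ, v = s + x • a + y • b) →
      f v = MvPolynomial.eval (ratPoint v) P' := by
    rintro v ⟨hv1, hv2⟩ ⟨x, y, hv⟩
    have hαv : α v = α s + x * q := by
      rw [hv]; simp only [α_add, α_smul, hαa, hαb]; ring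
    have hβv : β v = β s + y * q := by
      rw [hv]; simp only [β_add, β_smul, hβa, hβb]; ring
    have hx : 0 ≤ x := by
      by_contra hneg
      have : (x + 1) * q ≤ 0 := mul_nonpos_of_nonpos_of_nonneg (by omega) hqZ.le
      linarith
    have hy : 0 ≤ y := by
      by_contra hneg
      have : (y + 1) * q ≤ 0 := mul_nonpos_of_nonpos_of_nonneg (by omega) hqZ.le
      linarith
    lift x to ℕ using hx
    lift y to ℕ using hy
    rw [hP', hA, hB]
    have hq0 : (q : ℚ) ≠ 0 := by exact_mod_cast hq.ne'
    have hαv' : (e' * v.2 - v.1 : ℚ) = α s + x * q := by exact_mod_cast hαv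
    have hβv' : (v.1 - e * v.2 : ℚ) = β s + y * q := by exact_mod_cast hβv
    have e1 : (-(q : ℚ)⁻¹) * v.1 + (q : ℚ)⁻¹ * e' * v.2 + -((q : ℚ)⁻¹ * α s) = x := by
      field_simp; linarith
    have e2 : ((q : ℚ)⁻¹) * v.1 + -((q : ℚ)⁻¹ * e) * v.2 + -((q : ℚ)⁻¹ * β s) = y := by
      field_simp; linarith
    rw [e1, e2, ← hP, hv]
    simp
  obtain ⟨g, hg⟩ := exists_polynomial_of_iterate_fwdDiff_eq_zero (hRW w hwW) (hdiff w hwW) hu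
  obtain ⟨g', hg'⟩ : ∃ g' : Polynomial ℚ, ∀ n : ℕ,
      MvPolynomial.eval (ratPoint (u + n • w)) P' = g'.eval (n : ℚ) := by
    refine ⟨MvPolynomial.aeval ![Polynomial.C (u.1 : ℚ) + Polynomial.X * Polynomial.C (w.1 : ℚ),
      Polynomial.C (u.2 : ℚ) + Polynomial.X * Polynomial.C (w.2 : ℚ)] P', fun n => ?_⟩
    rw [← Polynomial.coe_evalRingHom, MvPolynomial.aeval_def, MvPolynomial.eval,
      MvPolynomial.hom_eval₂, MvPolynomial.coe_eval₂Hom]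
    congr 1
    · exact Subsingleton.elim _ _
    · funext i
      fin_cases i <;> simp [ratPoint]
  -- Along u + n w both f and P' are polynomial in n. They agree for n = 1 + j q, since q w lies in
  -- ℤa + ℤb; so they agree for all n, in particular at n = 0.
  have hgg' : g = g' := by
    refine Polynomial.eq_of_infinite_eval_eq g g' ?_
    refine Set.Infinite.mono (s := Set.range fun j : ℕ => ((1 + j * q : ℕ) : ℚ)) ?_ ?_
    · rintro _ ⟨j, rfl⟩
      simp only [Set.mem_ofPred_eq]
      rw [← hg, ← hg']
      refine hcorner _ (add_nsmul_mem_of_add_mem (hRW w hwW) hu _)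
        ⟨-(α (s - u) / q) + j * α w, -(β (s - u) / q) + j * β w, ?_⟩
      have hqw : (q : ℤ) • w = α w • a + β w • b := by
        apply ext_αβ
        · simp only [α_add, α_smul, hαa, hαb]; ring
        · simp only [β_add, β_smul, hβa, hβb]; ring
      have : (1 + j * q) • w = w + (j : ℤ) • ((q : ℤ) • w) := by
        rw [add_nsmul, one_nsmul, mul_nsmul', natCast_zsmul, natCast_zsmul]
      rw [this, ← add_assoc, huw, hqw, smul_add, add_smul, add_smul, mul_smul, mul_smul]
      abel
    · refine Set.infinite_range_of_injective fun i j hij => ?_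
      have : 1 + i * q = 1 + j * q := by exact_mod_cast hij
      exact Nat.eq_of_mul_eq_mul_right hq (by omega)
  have h1 := hg 0
  have h2 := hg' 0
  rw [zero_nsmul, add_zero] at h1 h2
  rw [h1, h2, hgg']

end Quasi

/-! ### Hilbert functions of bigraded modules -/

open DirectSum MvPolynomial

section Graded

variable {k : Type*} [Field k] {n : ℕ} {d : Fin n → ℤ}
    {M : Type*} [AddCommGroup M] [Module (MvPolynomial (Fin n) k) M]

/-- The elements of `N` mapped into `N'` by the variable `X i`. -/
noncomputable def colonX (N N' : Submodule (MvPolynomial (Fin n) k) M) (i : Fin n) :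
    Submodule (MvPolynomial (Fin n) k) M :=
  N ⊓ N'.comap (LinearMap.lsmul (MvPolynomial (Fin n) k) M (X i))

/-- The submodule `N' + X i • N`. -/
noncomputable def supX (N N' : Submodule (MvPolynomial (Fin n) k) M) (i : Fin n) :
    Submodule (MvPolynomial (Fin n) k) M :=
  N' ⊔ N.map (LinearMap.lsmul (MvPolynomial (Fin n) k) M (X i))

lemma mem_colonX {N N' : Submodule (MvPolynomial (Fin n) k) M} {i : Fin n} {x : M} :
    x ∈ colonX N N' i ↔ x ∈ N ∧ (X i : MvPolynomial (Fin n) k) • x ∈ N' := Iff.rfl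

lemma mem_supX {N N' : Submodule (MvPolynomial (Fin n) k) M} {i : Fin n} {x : M} :
    x ∈ supX N N' i ↔ ∃ y ∈ N', ∃ z ∈ N, y + (X i : MvPolynomial (Fin n) k) • z = x := by
  simp [supX, Submodule.mem_sup]

variable [Module k M] {𝓜 : ℤ × ℤ → Submodule k M}

lemma X_smul_mem [SetLike.GradedSMul (bigrading k d) 𝓜] (i : Fin n) {s : ℤ × ℤ} {x : M}
    (hx : x ∈ 𝓜 s) : (X i : MvPolynomial (Fin n) k) • x ∈ 𝓜 (s + (d i, 1)) := by
  have h : (X i : MvPolynomial (Fin n) k) ∈ bigrading k d (d i, 1) :=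
    isWeightedHomogeneous_X k _ i
  have := SetLike.GradedSMul.smul_mem h hx
  rwa [vadd_eq_add, add_comm] at this

variable [DirectSum.Decomposition 𝓜]

variable (𝓜) in
lemma exists_finite_degrees [Module.Finite (MvPolynomial (Fin n) k) M] :
    ∃ (G : Set M) (Γ : Set (ℤ × ℤ)), G.Finite ∧ Γ.Finite ∧
      Submodule.span (MvPolynomial (Fin n) k) G = ⊤ ∧
      ∀ g ∈ G, ∀ γ, (decompose 𝓜 g γ : M) ≠ 0 → γ ∈ Γ := by
  classical
  obtain ⟨G, hG⟩ := (Module.Finite.fg_top : (⊤ : Submodule (MvPolynomial (Fin n) k) M).FG)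
  refine ⟨G, ↑(G.biUnion fun g => (decompose 𝓜 g).support), G.finite_toSet,
    Finset.finite_toSet _, hG, fun g hg γ h => ?_⟩
  simp only [Finset.coe_biUnion, Set.mem_iUnion]
  exact ⟨g, hg, by simpa using h⟩

lemma decompose_X_smul [SetLike.GradedSMul (bigrading k d) 𝓜] (i : Fin n) (x : M) (s : ℤ × ℤ) :
    (decompose 𝓜 ((X i : MvPolynomial (Fin n) k) • x) (s + (d i, 1)) : M) =
      (X i : MvPolynomial (Fin n) k) • (decompose 𝓜 x s : M) := by
  induction x using DirectSum.Decomposition.inductionOn 𝓜 with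
  | zero => simp
  | @homogeneous j x =>
    have hx := X_smul_mem (d := d) i x.2
    by_cases hj : j = s
    · subst hj
      rw [decompose_of_mem_same _ hx, decompose_of_mem_same _ x.2]
    · rw [decompose_of_mem_ne _ hx (by simpa using hj), decompose_of_mem_ne _ x.2 hj, smul_zero]
  | add x y hx hy => simp [smul_add, decompose_add, hx, hy]

include d in
lemma isHomogeneous_colonX [SetLike.GradedSMul (bigrading k d) 𝓜]
    {N N' : Submodule (MvPolynomial (Fin n) k) M} (hN : N.IsHomogeneous 𝓜)
    (hN' : N'.IsHomogeneous 𝓜) (i : Fin n) :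
    (colonX N N' i).IsHomogeneous 𝓜 := by
  intro s x hx
  refine ⟨hN s hx.1, ?_⟩
  change (X i : MvPolynomial (Fin n) k) • (decompose 𝓜 x s : M) ∈ N'
  rw [← decompose_X_smul (d := d)]
  exact hN' _ hx.2

include d in
lemma isHomogeneous_supX [SetLike.GradedSMul (bigrading k d) 𝓜]
    {N N' : Submodule (MvPolynomial (Fin n) k) M} (hN : N.IsHomogeneous 𝓜)
    (hN' : N'.IsHomogeneous 𝓜) (i : Fin n) :
    (supX N N' i).IsHomogeneous 𝓜 := by
  intro s x hx
  obtain ⟨y, hy, z, hz, rfl⟩ := mem_supX.1 hx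
  obtain ⟨s, rfl⟩ : ∃ s', s = s' + (d i, 1) := ⟨s - (d i, 1), by simp⟩
  rw [decompose_add, DirectSum.add_apply, Submodule.coe_add, decompose_X_smul]
  exact mem_supX.2 ⟨_, hN' _ hy, _, hN _ hz, rfl⟩

/-- The products of a monomial and a component of a generator that have degree `s`. -/
def monomialMultiples (d : Fin n → ℤ) (𝓜 : ℤ × ℤ → Submodule k M) [DirectSum.Decomposition 𝓜]
    (G : Set M) (s : ℤ × ℤ) : Set M :=
  {y | ∃ (u : Fin n →₀ ℕ) (γ : ℤ × ℤ), ∃ g ∈ G, (decompose 𝓜 g γ : M) ≠ 0 ∧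
    Finsupp.weight (fun i => ((d i, 1) : ℤ × ℤ)) u + γ = s ∧
      y = monomial u (1 : k) • (decompose 𝓜 g γ : M)}

variable [IsScalarTower k (MvPolynomial (Fin n) k) M]

/-- The generators need not be homogeneous, so their components take their place. Multiplication by
a variable sends monomial multiples to monomial multiples, which carries the induction over
polynomial coefficients. -/
lemma decompose_mem_span_monomialMultiples [SetLike.GradedSMul (bigrading k d) 𝓜] {G : Set M}
    (hG : Submodule.span (MvPolynomial (Fin n) k) G = ⊤) (x : M) :
    ∀ s, (decompose 𝓜 x s : M) ∈ Submodule.span k (monomialMultiples d 𝓜 G s) := by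
  have hx : x ∈ Submodule.span (MvPolynomial (Fin n) k) G := hG ▸ Submodule.mem_top
  induction hx using Submodule.span_induction with
  | mem g hg =>
    intro s
    by_cases h0 : (decompose 𝓜 g s : M) = 0
    · rw [h0]; exact Submodule.zero_mem _
    · refine Submodule.subset_span ⟨0, s, g, hg, h0, by simp, ?_⟩
      rw [← C_apply, C_1, one_smul]
  | zero => intro s; simp
  | add x y _ _ hx hy =>
    intro s
    rw [decompose_add, DirectSum.add_apply, Submodule.coe_add]
    exact Submodule.add_mem _ (hx s) (hy s)
  | smul b x _ hx =>
    induction b using MvPolynomial.induction_on with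
    | C a =>
      intro s
      rw [← algebraMap_eq, algebraMap_smul, decompose_smul, DirectSum.smul_apply,
        Submodule.coe_smul]
      exact Submodule.smul_mem _ _ (hx s)
    | add p q hp hq =>
      intro s
      rw [add_smul, decompose_add, DirectSum.add_apply, Submodule.coe_add]
      exact Submodule.add_mem _ (hp s) (hq s)
    | mul_X p i hp =>
      intro s
      obtain ⟨s, rfl⟩ : ∃ s', s = s' + (d i, 1) := ⟨s - (d i, 1), by simp⟩
      rw [mul_comm, mul_smul, decompose_X_smul]
      let φ : M →ₗ[k] M := Algebra.lsmul k k M (X i : MvPolynomial (Fin n) k)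
      have h1 : φ (decompose 𝓜 (p • x) s : M) ∈
          (Submodule.span k (monomialMultiples d 𝓜 G s)).map φ :=
        Submodule.mem_map_of_mem (hp s)
      refine (Submodule.map_span_le φ _ _).2 ?_ h1
      rintro _ ⟨u, γ, g, hg, h0, rfl, rfl⟩
      refine Submodule.subset_span ⟨u + Finsupp.single i 1, γ, g, hg, h0, ?_, ?_⟩
      · rw [map_add, Finsupp.weight_single, one_smul, add_right_comm]
      · simp only [φ, Algebra.lsmul_coe]
        rw [← mul_smul, X, monomial_mul, one_mul, add_comm]

/-- The second coordinate of a degree counts the total degree of the monomial. This leaves finitely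
many monomials in each degree of M and none far below. -/
lemma weight_snd (u : Fin n →₀ ℕ) :
    (Finsupp.weight (fun i => ((d i, 1) : ℤ × ℤ)) u).2 = (u.degree : ℤ) := by
  rw [Finsupp.weight_apply, Finsupp.sum, Prod.snd_sum, Finsupp.degree_apply]
  simp

variable (d 𝓜)

lemma graded_eq_span [SetLike.GradedSMul (bigrading k d) 𝓜] {G : Set M}
    (hG : Submodule.span (MvPolynomial (Fin n) k) G = ⊤) (s : ℤ × ℤ) :
    𝓜 s ≤ Submodule.span k (monomialMultiples d 𝓜 G s) := by
  intro x hx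
  rw [← decompose_of_mem_same 𝓜 hx]
  exact decompose_mem_span_monomialMultiples hG x s

lemma finite_graded [SetLike.GradedSMul (bigrading k d) 𝓜]
    [Module.Finite (MvPolynomial (Fin n) k) M] (s : ℤ × ℤ) : Module.Finite k (𝓜 s) := by
  obtain ⟨G, Γ, hGf, hΓf, hG, hΓ⟩ := exists_finite_degrees (n := n) 𝓜
  have hfin : (monomialMultiples d 𝓜 G s).Finite := by
    obtain ⟨T, hT⟩ := (hΓf.image fun γ => s.2 - γ.2).bddAbove
    refine (((Finsupp.finite_of_degree_le (σ := Fin n) T.toNat).prod (hΓf.prod hGf)).image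
      fun p => monomial p.1 (1 : k) • (decompose 𝓜 p.2.2 p.2.1 : M)).subset ?_
    rintro _ ⟨u, γ, g, hg, h0, hs, rfl⟩
    refine ⟨(u, γ, g), ⟨?_, hΓ g hg γ h0, hg⟩, rfl⟩
    have h1 := hT ⟨γ, hΓ g hg γ h0, rfl⟩
    have h2 := congrArg Prod.snd hs
    rw [Prod.snd_add, weight_snd] at h2
    simp only [Set.mem_ofPred_eq] at h1 ⊢
    omega
  have : Module.Finite k (Submodule.span k (monomialMultiples d 𝓜 G s)) :=
    FiniteDimensional.span_of_finite k hfin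
  exact Submodule.finiteDimensional_of_le (graded_eq_span d 𝓜 hG s)

lemma exists_graded_eq_bot [SetLike.GradedSMul (bigrading k d) 𝓜]
    [Module.Finite (MvPolynomial (Fin n) k) M] :
    ∃ T : ℤ, ∀ s : ℤ × ℤ, s.2 < T → 𝓜 s = ⊥ := by
  obtain ⟨G, Γ, hGf, hΓf, hG, hΓ⟩ := exists_finite_degrees (n := n) 𝓜
  obtain ⟨T, hT⟩ := (hΓf.image Prod.snd).bddBelow
  refine ⟨T, fun s hs => ?_⟩
  rw [eq_bot_iff]
  refine (graded_eq_span d 𝓜 hG s).trans (Submodule.span_le.2 ?_)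
  rintro _ ⟨u, γ, g, hg, h0, hu, rfl⟩
  have h1 := hT ⟨γ, hΓ g hg γ h0, rfl⟩
  have h2 := congrArg Prod.snd hu
  rw [Prod.snd_add, weight_snd] at h2
  omega

variable {d 𝓜}

/-- The Hilbert function of a submodule. -/
noncomputable def hilbertFun (𝓜 : ℤ × ℤ → Submodule k M)
    (N : Submodule (MvPolynomial (Fin n) k) M) (s : ℤ × ℤ) : ℚ :=
  Module.finrank k ↥(N.restrictScalars k ⊓ 𝓜 s)

lemma finrank_map_add_finrank_inf_ker {V V' : Type*} [AddCommGroup V] [Module k V]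
    [AddCommGroup V'] [Module k V'] (φ : V →ₗ[k] V') (A : Submodule k V) [Module.Finite k A] :
    Module.finrank k (A.map φ) + Module.finrank k ↥(A ⊓ LinearMap.ker φ) =
      Module.finrank k A := by
  have h := LinearMap.finrank_range_add_finrank_ker (φ.domRestrict A)
  rw [LinearMap.range_domRestrict, LinearMap.ker_domRestrict] at h
  rw [← h]
  congr 1
  rw [← Submodule.map_comap_subtype]
  exact ((Submodule.equivSubtypeMap A _).finrank_eq).symm

/-- N / N' is finitely generated and killed by all variables, so it is spanned over k by the classes
of finitely many generators. Only the degrees of their components can contribute. -/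
lemma finite_support_of_X_smul_mem [Module.Finite (MvPolynomial (Fin n) k) M]
    {N N' : Submodule (MvPolynomial (Fin n) k) M} (hN' : N'.IsHomogeneous 𝓜) (hle : N' ≤ N)
    (hX : ∀ i, ∀ x ∈ N, (X i : MvPolynomial (Fin n) k) • x ∈ N') :
    (Function.support (hilbertFun 𝓜 N - hilbertFun 𝓜 N')).Finite := by
  classical
  have hnoeth : IsNoetherian (MvPolynomial (Fin n) k) M := inferInstance
  obtain ⟨G, hG⟩ := hnoeth.noetherian N
  have hdec : ∀ x ∈ N, ∃ c ∈ Submodule.span k (G : Set M), x - c ∈ N' := by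
    intro x hx
    rw [← hG] at hx
    induction hx using Submodule.span_induction with
    | mem g hg => exact ⟨g, Submodule.subset_span hg, by simp⟩
    | zero => exact ⟨0, Submodule.zero_mem _, by simp⟩
    | add x y _ _ hx hy =>
      obtain ⟨c, hc, hcx⟩ := hx
      obtain ⟨c', hc', hcy⟩ := hy
      exact ⟨c + c', Submodule.add_mem _ hc hc', by
        rw [add_sub_add_comm]; exact N'.add_mem hcx hcy⟩
    | smul b x hxN hx =>
      rw [hG] at hxN
      induction b using MvPolynomial.induction_on with
      | C a =>
        obtain ⟨c, hc, hcx⟩ := hx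
        refine ⟨a • c, Submodule.smul_mem _ _ hc, ?_⟩
        rw [← algebraMap_eq, algebraMap_smul, ← smul_sub]
        exact (N'.restrictScalars k).smul_mem a hcx
      | add p q hp hq =>
        obtain ⟨c, hc, hcx⟩ := hp
        obtain ⟨c', hc', hcy⟩ := hq
        exact ⟨c + c', Submodule.add_mem _ hc hc', by
          rw [add_smul, add_sub_add_comm]; exact N'.add_mem hcx hcy⟩
      | mul_X p i _ =>
        refine ⟨0, Submodule.zero_mem _, ?_⟩
        rw [sub_zero, mul_comm, mul_smul]
        exact hX i _ (N.smul_mem p hxN)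
  refine (G.biUnion fun g => (decompose 𝓜 g).support).finite_toSet.subset fun s hs => ?_
  by_contra hsG
  refine hs ?_
  have hzero : ∀ c ∈ Submodule.span k (G : Set M), (decompose 𝓜 c s : M) = 0 := by
    intro c hc
    induction hc using Submodule.span_induction with
    | mem g hg =>
      by_contra h
      exact hsG (Finset.mem_coe.2 (Finset.mem_biUnion.2 ⟨g, hg, by simpa using h⟩))
    | zero => simp
    | add x y _ _ hx hy => simp [decompose_add, hx, hy]
    | smul a x _ hx => rw [decompose_smul, DirectSum.smul_apply, Submodule.coe_smul, hx, smul_zero]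
  have : N.restrictScalars k ⊓ 𝓜 s = N'.restrictScalars k ⊓ 𝓜 s := by
    apply le_antisymm
    · rintro x ⟨hx, hxs⟩
      refine ⟨?_, hxs⟩
      obtain ⟨c, hc, hxc⟩ := hdec x hx
      have h1 := hN' s hxc
      rw [decompose_sub, DirectSum.sub_apply, AddSubgroupClass.coe_sub, hzero c hc, sub_zero,
        decompose_of_mem_same 𝓜 hxs] at h1
      exact h1
    · exact inf_le_inf_right _ hle
  simp only [Pi.sub_apply, hilbertFun]
  rw [this, sub_self]

section

variable [SetLike.GradedSMul (bigrading k d) 𝓜]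
    {N N' : Submodule (MvPolynomial (Fin n) k) M}

variable [Module.Finite (MvPolynomial (Fin n) k) M]

include d in
-- Both sides are the dimension of the image of N_s in M / N' under multiplication by X i.
lemma hilbertFun_supX (hN : N.IsHomogeneous 𝓜) (hN' : N'.IsHomogeneous 𝓜) (i : Fin n)
    (s : ℤ × ℤ) :
    hilbertFun 𝓜 (supX N N' i) (s + (d i, 1)) - hilbertFun 𝓜 N' (s + (d i, 1)) =
      hilbertFun 𝓜 N s - hilbertFun 𝓜 (colonX N N' i) s := by
  have hfin := finite_graded d 𝓜
  let π := (N'.restrictScalars k).mkQ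
  let φ : M →ₗ[k] M := Algebra.lsmul k k M (X i : MvPolynomial (Fin n) k)
  have hφ : ∀ x, φ x = (X i : MvPolynomial (Fin n) k) • x := fun x => rfl
  have : Module.Finite k ↥((supX N N' i).restrictScalars k ⊓ 𝓜 (s + (d i, 1))) :=
    Submodule.finiteDimensional_of_le inf_le_right
  have : Module.Finite k ↥(N.restrictScalars k ⊓ 𝓜 s) :=
    Submodule.finiteDimensional_of_le inf_le_right
  have h1 := finrank_map_add_finrank_inf_ker π ((supX N N' i).restrictScalars k ⊓ 𝓜 (s + (d i, 1)))
  have h2 := finrank_map_add_finrank_inf_ker (π ∘ₗ φ) (N.restrictScalars k ⊓ 𝓜 s)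
  have e1 : (supX N N' i).restrictScalars k ⊓ 𝓜 (s + (d i, 1)) ⊓ LinearMap.ker π =
      N'.restrictScalars k ⊓ 𝓜 (s + (d i, 1)) := by
    rw [Submodule.ker_mkQ]
    ext x
    simp only [Submodule.mem_inf, Submodule.restrictScalars_mem]
    constructor
    · rintro ⟨⟨_, h⟩, h'⟩; exact ⟨h', h⟩
    · rintro ⟨h', h⟩
      exact ⟨⟨mem_supX.2 ⟨x, h', 0, N.zero_mem, by simp⟩, h⟩, h'⟩
  have e2 : N.restrictScalars k ⊓ 𝓜 s ⊓ LinearMap.ker (π ∘ₗ φ) =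
      (colonX N N' i).restrictScalars k ⊓ 𝓜 s := by
    rw [LinearMap.ker_comp, Submodule.ker_mkQ]
    ext x
    simp only [Submodule.mem_inf, Submodule.restrictScalars_mem, Submodule.mem_comap, hφ,
      mem_colonX]
    tauto
  have e3 : ((supX N N' i).restrictScalars k ⊓ 𝓜 (s + (d i, 1))).map π =
      (N.restrictScalars k ⊓ 𝓜 s).map (π ∘ₗ φ) := by
    apply le_antisymm
    · rintro _ ⟨x, ⟨hx, hxs⟩, rfl⟩
      obtain ⟨y, hy, z, hz, rfl⟩ := mem_supX.1 hx
      refine ⟨(decompose 𝓜 z s : M), ⟨hN _ hz, SetLike.coe_mem _⟩, ?_⟩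
      have hd := decompose_of_mem_same 𝓜 hxs
      rw [decompose_add, DirectSum.add_apply, Submodule.coe_add, decompose_X_smul] at hd
      rw [← hd, map_add, LinearMap.comp_apply, hφ, right_eq_add]
      exact (Submodule.Quotient.mk_eq_zero _).2 (hN' _ hy)
    · rintro _ ⟨x, ⟨hx, hxs⟩, rfl⟩
      exact ⟨φ x, ⟨mem_supX.2 ⟨0, N'.zero_mem, x, hx, by simp [hφ]⟩, X_smul_mem i hxs⟩, rfl⟩
  rw [e1] at h1
  rw [e2] at h2
  rw [e3] at h1
  simp only [hilbertFun]
  rw [← h1, ← h2]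
  push_cast
  ring

end

/-- Multiplication by X i on N / N' has kernel `colonX` / N' and cokernel N / `supX`. Hence x^{δ_i}
- 1 applied to the Hilbert function of N / N' gives a translate of that of the cokernel minus that
of the kernel. X i kills both, so i can be removed from S. Working with pairs of submodules of M
avoids grading the quotients. -/
lemma finite_support_prod_diffElt [SetLike.GradedSMul (bigrading k d) 𝓜]
    [Module.Finite (MvPolynomial (Fin n) k) M] (S : Finset (Fin n)) :
    ∀ {N N' : Submodule (MvPolynomial (Fin n) k) M}, N.IsHomogeneous 𝓜 → N'.IsHomogeneous 𝓜 →
      N' ≤ N → (∀ i ∉ S, ∀ x ∈ N, (X i : MvPolynomial (Fin n) k) • x ∈ N') →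
      (Function.support (shiftAction (∏ i ∈ S, diffElt ((d i, 1) : ℤ × ℤ))
        (hilbertFun 𝓜 N - hilbertFun 𝓜 N'))).Finite := by
  classical
  induction S using Finset.induction_on with
  | empty =>
    intro N N' _ hN' hle hX
    simpa using finite_support_of_X_smul_mem hN' hle fun i => hX i (by simp)
  | insert i S hi ih =>
    intro N N' hN hN' hle hX
    have hK := isHomogeneous_colonX (d := d) hN hN' i
    have hC := isHomogeneous_supX (d := d) hN hN' i
    have hC_le : supX N N' i ≤ N := by
      intro x hx
      obtain ⟨y, hy, z, hz, rfl⟩ := mem_supX.1 hx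
      exact N.add_mem (hle hy) (N.smul_mem _ hz)
    have h1 := ih hN hC hC_le fun j hj x hx => by
      by_cases hji : j = i
      · subst hji
        exact mem_supX.2 ⟨0, N'.zero_mem, x, hx, by simp⟩
      · exact mem_supX.2 ⟨_, hX j (by simp [hji, hj]) x hx, 0, N.zero_mem, by simp⟩
    have h2 := ih hK hN' (fun x hx => ⟨hle hx, N'.smul_mem _ hx⟩) fun j hj x hx => by
      by_cases hji : j = i
      · subst hji; exact hx.2
      · exact hX j (by simp [hji, hj]) x hx.1
    have key : shiftAction (diffElt ((d i, 1) : ℤ × ℤ)) (hilbertFun 𝓜 N - hilbertFun 𝓜 N') =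
        shiftAction (AddMonoidAlgebra.single ((d i, 1) : ℤ × ℤ) 1)
          (hilbertFun 𝓜 N - hilbertFun 𝓜 (supX N N' i)) -
        (hilbertFun 𝓜 (colonX N N' i) - hilbertFun 𝓜 N') := by
      ext s
      have := hilbertFun_supX (d := d) hN hN' i s
      simp only [shiftAction_diffElt, fwdDiff, Pi.sub_apply, shiftAction_single]
      linarith
    rw [Finset.prod_insert hi, mul_comm, map_mul, Module.End.mul_apply, key, map_sub,
      ← Module.End.mul_apply, ← map_mul, mul_comm, map_mul, Module.End.mul_apply]
    refine ((h1.preimage ((add_left_injective ((d i, 1) : ℤ × ℤ)).injOn)).union h2).subset ?_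
    intro s hs
    by_contra hcon
    simp only [Set.mem_union, Set.mem_preimage, Function.mem_support, not_or, not_not] at hcon
    refine hs ?_
    rw [Pi.sub_apply, shiftAction_single, hcon.1, hcon.2]
    simp

variable (d 𝓜)

/-- The Hilbert function of a finitely generated bigraded module. -/
theorem hilbertLike_finrank [SetLike.GradedSMul (bigrading k d) 𝓜]
    [Module.Finite (MvPolynomial (Fin n) k) M] :
    HilbertLike (fun i => ((d i, 1) : ℤ × ℤ)) fun s => (Module.finrank k (𝓜 s) : ℚ) := by
  constructor
  · obtain ⟨T, hT⟩ := exists_graded_eq_bot d 𝓜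
    exact ⟨T, fun s hs => by rw [hT s hs]; simp⟩
  · have h := finite_support_prod_diffElt (d := d) (𝓜 := 𝓜) Finset.univ (N := ⊤) (N' := ⊥)
      (fun _ _ _ => Submodule.mem_top) (fun s x hx => by
        have : x = 0 := hx
        subst this
        simp) bot_le (by simp)
    convert h using 3
    ext s
    have h₀ : (⊥ : Submodule (MvPolynomial (Fin n) k) M).restrictScalars k ⊓ 𝓜 s = ⊥ := by
      simp
    have h₁ : (⊤ : Submodule (MvPolynomial (Fin n) k) M).restrictScalars k ⊓ 𝓜 s = 𝓜 s := by
      simp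
    rw [Pi.sub_apply, hilbertFun, hilbertFun, h₀, h₁, finrank_bot, Nat.cast_zero, sub_zero]

end Graded

/-! ### The lattice Λ has finite index -/

section Lattice

variable {n : ℕ} (d : Fin n → ℤ)

lemma degreeLattice_le_closure {i j : Fin n} (hij : d i < d j) :
    degreeLattice (Set.range d) ≤ AddSubgroup.closure {((d i, 1) : ℤ × ℤ), (d j, 1)} :=
  (iInf₂_le (d i) ⟨i, rfl⟩).trans <| (iInf₂_le (d j) ⟨j, rfl⟩).trans <| iInf_le _ hij

/-- Cramer's rule for the basis (e, 1), (e', 1), of determinant e - e'. -/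
lemma sub_smul_mem_closure (e e' : ℤ) (s : ℤ × ℤ) :
    (e' - e) • s ∈ AddSubgroup.closure {((e, 1) : ℤ × ℤ), (e', 1)} := by
  have : (e' - e) • s =
      (e' * s.2 - s.1) • ((e, 1) : ℤ × ℤ) + (s.1 - e * s.2) • ((e', 1) : ℤ × ℤ) := by
    ext
    · simp; ring
    · simp; ring
  rw [this]
  exact add_mem (zsmul_mem (AddSubgroup.subset_closure (by simp)) _)
    (zsmul_mem (AddSubgroup.subset_closure (by simp)) _)

lemma exists_smul_mem_degreeLattice :
    ∃ p : ℕ, 0 < p ∧ ∀ s : ℤ × ℤ, p • s ∈ degreeLattice (Set.range d) := by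
  classical
  let c : Fin n × Fin n → ℕ := fun x => if d x.1 < d x.2 then (d x.2 - d x.1).toNat else 1
  refine ⟨∏ x, c x, Finset.prod_pos fun x _ => ?_, fun s => ?_⟩
  · simp only [c]
    split_ifs <;> omega
  · simp only [degreeLattice, AddSubgroup.mem_iInf]
    rintro _ ⟨i, rfl⟩ _ ⟨j, rfl⟩ hij
    obtain ⟨r, hr⟩ := Finset.dvd_prod_of_mem c (Finset.mem_univ (i, j))
    have hc : (c (i, j) : ℤ) = d j - d i := by
      simp only [c, if_pos hij]; omega
    rw [hr, ← natCast_zsmul, Nat.cast_mul, hc, mul_smul]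
    exact sub_smul_mem_closure _ _ _

end Lattice

/-! ### Chambers, lines and strips -/

/-- The linear form `(x, t) ↦ a * x + b * t`. -/
def linForm (a b : ℤ) : ℤ × ℤ →+ ℤ :=
  (AddMonoidHom.mulLeft a).comp (AddMonoidHom.fst ℤ ℤ) +
    (AddMonoidHom.mulLeft b).comp (AddMonoidHom.snd ℤ ℤ)

lemma linForm_apply (a b : ℤ) (s : ℤ × ℤ) : linForm a b s = a * s.1 + b * s.2 := rfl

section Chambers

variable {n : ℕ} {d : Fin n → ℤ} {f : ℤ × ℤ → ℚ}

lemma HilbertLike.exists_eq_zero_right (hf : HilbertLike (fun i => ((d i, 1) : ℤ × ℤ)) f) {e : ℤ}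
    (he : ∀ i, d i ≤ e) : ∃ C : ℤ, ∀ s : ℤ × ℤ, C < s.1 - e * s.2 → f s = 0 := by
  obtain ⟨C, hC⟩ := hf.vanishesFar_prod (fun _ => rfl) (ℓ := linForm 1 (-e)) ∅
    (fun i _ => by simp [linForm_apply, he i])
  refine ⟨C, fun s hs => ?_⟩
  simpa using hC s (by rw [linForm_apply]; linarith)

lemma HilbertLike.exists_eq_zero_left (hf : HilbertLike (fun i => ((d i, 1) : ℤ × ℤ)) f) {e : ℤ}
    (he : ∀ i, e ≤ d i) : ∃ C : ℤ, ∀ s : ℤ × ℤ, C < e * s.2 - s.1 → f s = 0 := by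
  obtain ⟨C, hC⟩ := hf.vanishesFar_prod (fun _ => rfl) (ℓ := linForm (-1) e) ∅
    (fun i _ => by simp [linForm_apply, he i])
  refine ⟨C, fun s hs => ?_⟩
  simpa using hC s (by rw [linForm_apply]; linarith)

/-- In the interior of a chamber a Hilbert function is a quasi-polynomial. -/
lemma HilbertLike.exists_isQuasiPolynomial_on_chamber
    (hf : HilbertLike (fun i => ((d i, 1) : ℤ × ℤ)) f) {e e' : ℤ} (hee' : e < e')
    (h : ∀ i, d i ≤ e ∨ e' ≤ d i) :
    ∃ (C : ℤ) (Q : ℤ × ℤ → ℚ), IsQuasiPolynomial (degreeLattice (Set.range d)) Q ∧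
      ∀ s : ℤ × ℤ, C ≤ e' * s.2 - s.1 → C ≤ s.1 - e * s.2 → f s = Q s := by
  classical
  obtain ⟨p, hp, hpΛ⟩ := exists_smul_mem_degreeLattice d
  refine exists_isQuasiPolynomial_on_cone f hee' hp hpΛ fun l hl => ?_
  obtain ⟨m, C, hC⟩ := hf.exists_iterate_fwdDiff_eq_zero (fun _ => rfl)
    (ℓ₁ := linForm (-1) e') (ℓ₂ := linForm 1 (-e))
    (Finset.univ.filter fun i => d i ≤ e) (Finset.univ.filter fun i => e' ≤ d i)
    (fun i hi => by
      have := (h i).resolve_left (by simpa using hi)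
      simp [linForm_apply, this])
    (fun i hi => by
      have := (h i).resolve_right (by simpa using hi)
      simp [linForm_apply, this]) l
    (fun i hi j hj => by
      simp only [Finset.mem_filter, Finset.mem_univ, true_and] at hi hj
      exact degreeLattice_le_closure d (by omega) hl)
  exact ⟨m, C, fun s h₁ h₂ => hC s (by rw [linForm_apply]; linarith)
    (by rw [linForm_apply]; linarith)⟩

/-- Along every line a Hilbert function is eventually a quasi-polynomial. -/
lemma HilbertLike.exists_isQuasiPolynomial_on_line
    (hf : HilbertLike (fun i => ((d i, 1) : ℤ × ℤ)) f) (e b : ℤ) :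
    ∃ (t₀ : ℤ) (Q : ℤ × ℤ → ℚ), IsQuasiPolynomial (degreeLattice (Set.range d)) Q ∧
      ∀ t, t₀ ≤ t → f (e * t + b, t) = Q (e * t + b, t) := by
  classical
  refine BigradedHilbert.exists_isQuasiPolynomial_on_line f e b fun r hr => ?_
  obtain ⟨m, C, hC⟩ := hf.exists_iterate_fwdDiff_eq_zero (fun _ => rfl)
    -- Tilting the slope e by 1 to either side makes both forms grow along the line: their values at
    -- (e t + b, t) are t - b and t + b. Integrality of d i keeps slope e itself in both index sets.
    (ℓ₁ := linForm (-1) (e + 1)) (ℓ₂ := linForm 1 (-(e - 1)))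
    (Finset.univ.filter fun i => d i ≤ e) (Finset.univ.filter fun i => e ≤ d i)
    (fun i hi => by
      simp only [Finset.mem_filter, Finset.mem_univ, true_and] at hi
      rw [linForm_apply]; dsimp only; omega)
    (fun i hi => by
      simp only [Finset.mem_filter, Finset.mem_univ, true_and] at hi
      rw [linForm_apply]; dsimp only; omega) (r * e, r)
    (fun i hi j hj => by
      simp only [Finset.mem_filter, Finset.mem_univ, true_and] at hi hj
      rcases lt_or_ge (d i) (d j) with hij | hij
      · exact degreeLattice_le_closure d hij hr
      · have h₁ : d i = e := by omega
        have : ((r * e, r) : ℤ × ℤ) = r • ((d i, 1) : ℤ × ℤ) := by simp [h₁]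
        rw [this]
        exact zsmul_mem (AddSubgroup.subset_closure (by simp)) _)
  refine ⟨m, max (C + b) (C - b) + 1, fun t ht => hC _ ?_ ?_⟩
  · rw [linForm_apply]; dsimp only; linarith [le_max_left (C + b) (C - b)]
  · rw [linForm_apply]; dsimp only; linarith [le_max_right (C + b) (C - b)]

/-- Between neighbouring parallel lines a Hilbert function is eventually a quasi-polynomial. -/
lemma HilbertLike.exists_isQuasiPolynomial_on_strip
    (hf : HilbertLike (fun i => ((d i, 1) : ℤ × ℤ)) f) (e b : ℤ) :
    ∃ (t₀ : ℤ) (Q : ℤ × ℤ → ℚ), IsQuasiPolynomial (degreeLattice (Set.range d)) Q ∧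
      ∀ t, t₀ ≤ t → ∀ μ, e * t + b ≤ μ → μ ≤ e * t + (b + 1) → f (μ, t) = Q (μ, t) := by
  obtain ⟨t₁, Q₁, hQ₁, h₁⟩ := hf.exists_isQuasiPolynomial_on_line e b
  obtain ⟨t₂, Q₂, hQ₂, h₂⟩ := hf.exists_isQuasiPolynomial_on_line e (b + 1)
  refine ⟨max t₁ t₂, _, isQuasiPolynomial_interpolate hQ₁ hQ₂ e b, fun t ht μ hμ hμ' => ?_⟩
  obtain rfl | rfl : μ = e * t + b ∨ μ = e * t + (b + 1) := by omega
  · rw [h₁ t (le_trans (le_max_left _ _) ht)]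
    simp [add_assoc]
  · rw [h₂ t (le_trans (le_max_right _ _) ht)]
    simp [add_assoc]

/-- A bound `C` that works simultaneously for the vanishing of a Hilbert function and for
all chambers. -/
lemma HilbertLike.exists_uniform_bound (hf : HilbertLike (fun i => ((d i, 1) : ℤ × ℤ)) f)
    (hn : 0 < n) :
    ∃ C : ℤ, 0 ≤ C ∧
      (∃ i, ∀ s : ℤ × ℤ, C < d i * s.2 - s.1 → f s = 0) ∧
      (∃ i, ∀ s : ℤ × ℤ, C < s.1 - d i * s.2 → f s = 0) ∧
      ∀ i j, d i < d j → (∀ l, d l ≤ d i ∨ d j ≤ d l) →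
        ∃ Q : ℤ × ℤ → ℚ, IsQuasiPolynomial (degreeLattice (Set.range d)) Q ∧
          ∀ s : ℤ × ℤ, C ≤ d j * s.2 - s.1 → C ≤ s.1 - d i * s.2 → f s = Q s := by
  have : Nonempty (Fin n) := ⟨⟨0, hn⟩⟩
  obtain ⟨i₀, hi₀⟩ := Finite.exists_min d
  obtain ⟨i₁, hi₁⟩ := Finite.exists_max d
  obtain ⟨C₀, hC₀⟩ := hf.exists_eq_zero_left hi₀
  obtain ⟨C₁, hC₁⟩ := hf.exists_eq_zero_right hi₁
  have h : ∀ x : Fin n × Fin n, ∃ C : ℤ, d x.1 < d x.2 → (∀ l, d l ≤ d x.1 ∨ d x.2 ≤ d l) →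
        ∃ Q : ℤ × ℤ → ℚ, IsQuasiPolynomial (degreeLattice (Set.range d)) Q ∧
          ∀ s : ℤ × ℤ, C ≤ d x.2 * s.2 - s.1 → C ≤ s.1 - d x.1 * s.2 → f s = Q s := by
    intro x
    by_cases hx : d x.1 < d x.2 ∧ ∀ l, d l ≤ d x.1 ∨ d x.2 ≤ d l
    · obtain ⟨C, Q, hQ⟩ := hf.exists_isQuasiPolynomial_on_chamber hx.1 hx.2
      exact ⟨C, fun _ _ => ⟨Q, hQ⟩⟩
    · exact ⟨0, fun h1 h2 => absurd ⟨h1, h2⟩ hx⟩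
  choose C hC using h
  obtain ⟨B, hB⟩ := (Set.finite_range C).bddAbove
  have hB' : ∀ x, C x ≤ B := fun x => hB ⟨x, rfl⟩
  refine ⟨max (max C₀ C₁) (max B 0), by simp, ⟨i₀, fun s hs => hC₀ s (by omega)⟩,
    ⟨i₁, fun s hs => hC₁ s (by omega)⟩, fun i j hij hl => ?_⟩
  obtain ⟨Q, hQ, hfQ⟩ := hC (i, j) hij hl
  have := hB' (i, j)
  exact ⟨Q, hQ, fun s h₁ h₂ => hfQ s (by dsimp only; omega) (by dsimp only; omega)⟩

/-- The lines are all e t + b with e among the d i and -C ≤ b ≤ C, in lexicographic order of (e, b).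
Consecutive lines either have equal slope and offsets differing by 1, so that all integer points
between them lie on the two lines, or bound a chamber at depth C. -/
theorem HilbertLike.exists_lines (hf : HilbertLike (fun i => ((d i, 1) : ℤ × ℤ)) f)
    (hn : 0 < n) :
    ∃ (t₀ : ℤ) (N : ℕ) (a b : Fin (N + 1) → ℤ) (Q : Fin N → ℤ × ℤ → ℚ),
      Set.range a = Set.range d ∧
      (∀ i, IsQuasiPolynomial (degreeLattice (Set.range d)) (Q i)) ∧
      ∀ t : ℤ, t₀ ≤ t →
        (∀ i j, a i * t + b i < a j * t + b j ↔ i < j) ∧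
        (∀ μ : ℤ, μ < a 0 * t + b 0 ∨ a (Fin.last N) * t + b (Fin.last N) < μ →
          f (μ, t) = 0) ∧
        (∀ (i : Fin N) (μ : ℤ),
          a i.castSucc * t + b i.castSucc ≤ μ → μ ≤ a i.succ * t + b i.succ →
            f (μ, t) = Q i (μ, t)) := by
  classical
  obtain ⟨C, hC0, ⟨i₀, hi₀⟩, ⟨i₁, hi₁⟩, hch⟩ := hf.exists_uniform_bound hn
  let F : Finset (ℤ ×ₗ ℤ) := ((Finset.univ.image d) ×ˢ Finset.Icc (-C) C).map toLex.toEmbedding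
  have hF : ∀ e b : ℤ, toLex (e, b) ∈ F ↔ (∃ i, d i = e) ∧ -C ≤ b ∧ b ≤ C := by
    intro e b
    simp [F]
  have hFne : 0 < F.card := Finset.card_pos.2 ⟨toLex (d i₀, 0), (hF _ _).2 ⟨⟨i₀, rfl⟩, by omega⟩⟩
  obtain ⟨N, hN⟩ : ∃ N, F.card = N + 1 := ⟨F.card - 1, by omega⟩
  let σ : Fin (N + 1) ≃o F := F.orderIsoOfFin hN
  let a : Fin (N + 1) → ℤ := fun i => (ofLex (σ i).1).1
  let b : Fin (N + 1) → ℤ := fun i => (ofLex (σ i).1).2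
  have hab : ∀ i, (∃ j, d j = a i) ∧ -C ≤ b i ∧ b i ≤ C := fun i => (hF _ _).1 (σ i).2
  have hσlt : ∀ i j, i < j ↔ a i < a j ∨ a i = a j ∧ b i < b j := by
    intro i j
    rw [← σ.lt_iff_lt, ← Subtype.coe_lt_coe, Prod.Lex.lt_iff]
  have hsurj : ∀ e b', (∃ i, d i = e) → -C ≤ b' → b' ≤ C → ∃ i, a i = e ∧ b i = b' := by
    intro e b' h1 h2 h3
    obtain ⟨i, hi⟩ := σ.surjective ⟨toLex (e, b'), (hF _ _).2 ⟨h1, h2, h3⟩⟩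
    exact ⟨i, by simp [a, hi], by simp [b, hi]⟩
  have hcov : ∀ (i : Fin N) (j : Fin (N + 1)), i.castSucc < j → i.succ ≤ j := by
    intro i j hij
    simpa [Fin.lt_def, Fin.le_def, Nat.succ_le_iff] using hij
  -- the lines are ordered for large `t`
  have hmono : ∀ t : ℤ, 2 * C + 1 ≤ t → StrictMono fun i => a i * t + b i := by
    intro t ht i j hij
    have hi := (hab i).2
    have hj := (hab j).2
    rcases (hσlt i j).1 hij with h | ⟨h, h'⟩
    -- A slope gap of at least 1 outweighs an offset gap of at most 2C once t > 2C.
    · have : 1 * t ≤ (a j - a i) * t := mul_le_mul_of_nonneg_right (by omega) (by omega)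
      simp only
      linarith
    · simp only [h]; omega
  have hQ : ∀ i : Fin N, ∃ (t₀ : ℤ) (Q : ℤ × ℤ → ℚ),
      IsQuasiPolynomial (degreeLattice (Set.range d)) Q ∧ ∀ t, t₀ ≤ t → ∀ μ,
        a i.castSucc * t + b i.castSucc ≤ μ → μ ≤ a i.succ * t + b i.succ →
          f (μ, t) = Q (μ, t) := by
    intro i
    obtain ⟨⟨j₁, hj₁⟩, hb₁, hb₁'⟩ := hab i.castSucc
    obtain ⟨⟨j₂, hj₂⟩, hb₂, hb₂'⟩ := hab i.succ
    have hnb : ∀ j, ¬ (i.castSucc < j ∧ j < i.succ) := fun j h =>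
      absurd (hcov i j h.1) (not_le.2 h.2)
    rcases (hσlt _ _).1 (Fin.castSucc_lt_succ (i := i)) with h | ⟨h, h'⟩
    · have e₁ : b i.castSucc = C := by
        by_contra hne
        obtain ⟨j, hja, hjb⟩ := hsurj (a i.castSucc) C ⟨j₁, hj₁⟩ (by omega) le_rfl
        exact hnb j ⟨(hσlt _ _).2 (Or.inr ⟨hja.symm, by omega⟩), (hσlt _ _).2 (Or.inl (by omega))⟩
      have e₂ : b i.succ = -C := by
        by_contra hne
        obtain ⟨j, hja, hjb⟩ := hsurj (a i.succ) (-C) ⟨j₂, hj₂⟩ le_rfl (by omega)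
        exact hnb j ⟨(hσlt _ _).2 (Or.inl (by omega)), (hσlt _ _).2 (Or.inr ⟨hja, by omega⟩)⟩
      -- A slope strictly between the two would give a line with offset 0 between consecutive lines.
      obtain ⟨Q, hQ, hfQ⟩ := hch j₁ j₂ (by omega) fun l => by
        by_contra hl
        obtain ⟨j, hja, hjb⟩ := hsurj (d l) 0 ⟨l, rfl⟩ (by omega) hC0
        exact hnb j ⟨(hσlt _ _).2 (Or.inl (by omega)), (hσlt _ _).2 (Or.inl (by omega))⟩
      refine ⟨0, Q, hQ, fun t _ μ h1 h2 => hfQ _ ?_ ?_⟩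
      · dsimp only; rw [hj₂]; omega
      · dsimp only; rw [hj₁]; omega
    · have e₁ : b i.succ = b i.castSucc + 1 := by
        by_contra hne
        obtain ⟨j, hja, hjb⟩ := hsurj (a i.castSucc) (b i.castSucc + 1) ⟨j₁, hj₁⟩ (by omega)
          (by omega)
        exact hnb j ⟨(hσlt _ _).2 (Or.inr ⟨hja.symm, by omega⟩),
          (hσlt _ _).2 (Or.inr ⟨by omega, by omega⟩)⟩
      rw [e₁, ← h]
      exact hf.exists_isQuasiPolynomial_on_strip _ _
  choose T Q hQ hfQ using hQ
  obtain ⟨T₀, hT₀⟩ := (Set.finite_range T).bddAbove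
  refine ⟨max T₀ (2 * C + 1), N, a, b, Q, ?_, hQ, fun t ht => ⟨?_, ?_, ?_⟩⟩
  · ext e
    constructor
    · rintro ⟨i, rfl⟩
      exact (hab i).1
    · intro he
      obtain ⟨i, hi, _⟩ := hsurj e 0 he (by omega) hC0
      exact ⟨i, hi⟩
  · intro i j
    exact (hmono t (by omega)).lt_iff_lt
  · have hm := (hmono t (by omega)).monotone
    rintro μ (hμ | hμ)
    · obtain ⟨i, hia, hib⟩ := hsurj (d i₀) (-C) ⟨i₀, rfl⟩ le_rfl (by omega)
      have h1 := hm (Fin.zero_le i)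
      simp only [hia, hib] at h1
      exact hi₀ _ (by dsimp only; omega)
    · obtain ⟨i, hia, hib⟩ := hsurj (d i₁) C ⟨i₁, rfl⟩ (by omega) le_rfl
      have h1 := hm (Fin.le_last i)
      simp only [hia, hib] at h1
      exact hi₁ _ (by dsimp only; omega)
  · intro i μ h1 h2
    exact hfQ i t (le_trans (hT₀ ⟨i, rfl⟩) (le_trans (le_max_left _ _) ht)) μ h1 h2

end Chambers

end BigradedHilbert

theorem proposition4p5 {k : Type*} [Field k] {n : ℕ} (hn : 0 < n) (d : Fin n → ℤ)
    {M : Type*} [AddCommGroup M] [Module k M] [Module (MvPolynomial (Fin n) k) M]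
    [IsScalarTower k (MvPolynomial (Fin n) k) M]
    [Module.Finite (MvPolynomial (Fin n) k) M]
    (𝓜 : ℤ × ℤ → Submodule k M) [DirectSum.Decomposition 𝓜]
    [SetLike.GradedSMul (bigrading k d) 𝓜] :
    -- the lines are `L i t = a i * t + b i`, for `i = 0, …, N`
    ∃ (t₀ : ℤ) (N : ℕ) (a b : Fin (N + 1) → ℤ) (Q : Fin N → ℤ × ℤ → ℚ),
      Set.range a = Set.range d ∧
      (∀ i, IsQuasiPolynomial (degreeLattice (Set.range d)) (Q i)) ∧
      ∀ t : ℤ, t₀ ≤ t →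
        (∀ i j, a i * t + b i < a j * t + b j ↔ i < j) ∧
        (∀ μ : ℤ, μ < a 0 * t + b 0 ∨ a (Fin.last N) * t + b (Fin.last N) < μ →
          𝓜 (μ, t) = ⊥) ∧
        (∀ (i : Fin N) (μ : ℤ),
          a i.castSucc * t + b i.castSucc ≤ μ → μ ≤ a i.succ * t + b i.succ →
            Module.Finite k (𝓜 (μ, t)) ∧
              (Module.finrank k (𝓜 (μ, t)) : ℚ) = Q i (μ, t)) := by
  have hfin := BigradedHilbert.finite_graded d 𝓜
  obtain ⟨t₀, N, a, b, Q, ha, hQ, h⟩ :=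
    (BigradedHilbert.hilbertLike_finrank d 𝓜).exists_lines hn
  refine ⟨t₀, N, a, b, Q, ha, hQ, fun t ht => ⟨(h t ht).1, fun μ hμ => ?_, fun i μ h₁ h₂ =>
    ⟨hfin _, (h t ht).2.2 i μ h₁ h₂⟩⟩⟩
  -- Rank 0 forces the component to vanish because it is finite-dimensional.
  exact Submodule.finrank_eq_zero.1 (Nat.cast_eq_zero.1 ((h t ht).2.1 μ hμ))
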